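/- Let $\mathbb R^\infty=\bigcup_{n\ge 1}\mathbb R^n$ and let $p_1=2,p_2=3,\dots$ be the primes in increasing order. An additive machine in $\mathsf M^1_{\mathrm{add}}(\mathcal O)$ with oracle $\mathcal O\subseteq\mathbb R^\infty$ has registers $Z_1,Z_2,\dots$ for real numbers and finitely many index registers $I_1,\dots,I_m$ for positive integers. Its program is a finite list of labeled instructions of the forms $Z_i:=Z_j+Z_k$; $Z_i:=Z_j-Z_k$; $Z_j:=0$; $Z_j:=1$; if $Z_j\ge 0$ then goto $l_1$ else goto $l_2$; $Z_{I_j}:=Z_{I_k}$; $I_j:=1$; $I_j:=I_j+1$; if $I_j=I_k$ then goto $l_1$ else goto $l_2$; if $(Z_1,\dots,Z_{I_1})\in\mathcal O$ then goto $l_1$ else goto $l_2$. On input $(x_1,\dots,x_n)\in\mathbb R^\infty$ it starts with $Z_j=x_j$ for $j\le n$, $Z_j=0$ for $j>n$, and every $I_j=n$; when it halts, its output is $(Z_1,\dots,Z_{I_1})$. $\mathsf M^1_{\mathrm{add}}$ is the class of those machines without oracle instructions. For $\mathcal A,\mathcal B\subseteq\mathbb R^\infty$, write $\mathcal A\preceq\mathcal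 B$ (strong Turing reducibility) if some machine in $\mathsf M^1_{\mathrm{add}}(\mathcal B)$ halts on every input in $\mathbb R^\infty$, with output $1$ if the input is in $\mathcal A$ and output $0$ otherwise. Let $\mathcal K$ be a machine in $\mathsf M^1_{\mathrm{add}}$ (for instance one that semi-decides $\bigcup_{i\ge 1}\{i\}\times(\mathbb R\setminus\{\sqrt{p_i}\})$), and let $\mathrm{code}(\mathcal K)$ be the tuple of zeros and ones obtained from the text of its program by replacing each single symbol by its block of $k$ zeros and ones, for some fixed $k$ and some fixed injective assignment of blocks to symbols. For $i\ge1$ put $$\mathbb P_i=\{(2,i,x,\mathrm{code}(\mathcal K)) : x\in\mathbb R\setminus\{\sqrt{p_i}\}\}.$$ Then for every $i\ge 1$, $$\{\sqrt{p_{i+1}}\}\not\preceq\bigcup_{1\le j\le i}\mathbb P_j\qquad\text{and}\qquad \{\sqrt{p_{i+1}}\}\not\preceq\{\sqrt{p_1},\dots,\sqrt{p_i}\}.$$ -/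

import Mathlib

namespace AddBSS

/-!  Problems are sets of non-empty real tuples; a tuple `(x₁, …, xₙ)`, `n ≥ 1`, is the list
`[x₁, …, xₙ]`. The empty list is never an input and never a query. -/

/-- Instructions of the additive oracle machines over `(ℝ; 0, 1; +, -; ≥)`. Registers
`Z₁, Z₂, …` and index registers `I₁, I₂, …` are numbered by `ℕ+`, and labels are line numbers
`0, 1, 2, …` of the program. -/
inductive Instr where
  /-- `Z_i := Z_j + Z_k` -/
  | add (i j k : ℕ+)
  /-- `Z_i := Z_j - Z_k` -/
  | sub (i j k : ℕ+)
  /-- `Z_j := 0` -/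
  | setZero (j : ℕ+)
  /-- `Z_j := 1` -/
  | setOne (j : ℕ+)
  /-- if `Z_j ≥ 0` then goto `l₁` else goto `l₂` -/
  | ifNonneg (j : ℕ+) (l₁ l₂ : ℕ)
  /-- `Z_{I_j} := Z_{I_k}` -/
  | copy (j k : ℕ+)
  /-- `I_j := 1` -/
  | idxOne (j : ℕ+)
  /-- `I_j := I_j + 1` -/
  | idxSucc (j : ℕ+)
  /-- if `I_j = I_k` then goto `l₁` else goto `l₂` -/
  | ifIdxEq (j k : ℕ+) (l₁ l₂ : ℕ)
  /-- if `(Z_1, …, Z_{I_1}) ∈ 𝒪` then goto `l₁` else goto `l₂` -/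
  | ifOracle (l₁ l₂ : ℕ)

/-- A program is a finite list of instructions. The line after the last instruction is an
implicit `stop`: the machine halts as soon as the current label is not a line of the program.
Only the finitely many index registers named in the program (and `I₁`) ever matter. -/
abbrev Program := List Instr

/-- The program has no oracle instruction, i.e. it is a machine in `M_add^1`. -/
def Program.OracleFree (P : Program) : Prop :=
  ∀ l₁ l₂ : ℕ, Instr.ifOracle l₁ l₂ ∉ P

/-- A configuration: current label, contents of `Z₁, Z₂, …`, contents of `I₁, I₂, …`. -/
structure Config where
  label : ℕ
  reg : ℕ+ → ℝ
  idx : ℕ+ → ℕ+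

/-- The tuple `(Z_1, …, Z_{I_1})`; it is both the tuple of a query and the output. -/
def Config.tuple (c : Config) : List ℝ :=
  (List.range (c.idx 1 : ℕ)).map fun m => c.reg m.succPNat

/-- The start configuration on input `w = (x₁, …, xₙ)`: `Z_j = x_j` for `j ≤ n`, all other
`Z_j` are `0`, and every index register contains `n`. -/
def Config.init (w : List ℝ) : Config where
  label := 0
  reg := fun j => w.getD j.natPred 0
  idx := fun _ => w.length.toPNat'

open Classical in
/-- The effect of one instruction, with oracle `O`. -/
noncomputable def Instr.exec (O : Set (List ℝ)) (c : Config) : Instr → Config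
  | .add i j k => ⟨c.label + 1, Function.update c.reg i (c.reg j + c.reg k), c.idx⟩
  | .sub i j k => ⟨c.label + 1, Function.update c.reg i (c.reg j - c.reg k), c.idx⟩
  | .setZero j => ⟨c.label + 1, Function.update c.reg j 0, c.idx⟩
  | .setOne j => ⟨c.label + 1, Function.update c.reg j 1, c.idx⟩
  | .ifNonneg j l₁ l₂ => ⟨if 0 ≤ c.reg j then l₁ else l₂, c.reg, c.idx⟩
  | .copy j k => ⟨c.label + 1, Function.update c.reg (c.idx j) (c.reg (c.idx k)), c.idx⟩
  | .idxOne j => ⟨c.label + 1, c.reg, Function.update c.idx j 1⟩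
  | .idxSucc j => ⟨c.label + 1, c.reg, Function.update c.idx j (c.idx j + 1)⟩
  | .ifIdxEq j k l₁ l₂ => ⟨if c.idx j = c.idx k then l₁ else l₂, c.reg, c.idx⟩
  | .ifOracle l₁ l₂ => ⟨if c.tuple ∈ O then l₁ else l₂, c.reg, c.idx⟩

/-- One step of the program; a configuration whose label is not a line is a fixed point. -/
noncomputable def Program.step (P : Program) (O : Set (List ℝ)) (c : Config) : Config :=
  match P[c.label]? with
  | some ins => ins.exec O c
  | none => c

/-- With oracle `O`, the program halts on input `w` with output `v`. -/
def Program.HaltsWith (P : Program) (O : Set (List ℝ)) (w v : List ℝ) : Prop :=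
  ∃ t : ℕ, P.length ≤ ((P.step O)^[t] (Config.init w)).label ∧
    ((P.step O)^[t] (Config.init w)).tuple = v

/-- With oracle `O`, the program computes the characteristic function of `A` on `ℝ^∞`. -/
def Program.Decides (P : Program) (O A : Set (List ℝ)) : Prop :=
  ∀ w : List ℝ, w ≠ [] →
    (w ∈ A → P.HaltsWith O w [1]) ∧ (w ∉ A → P.HaltsWith O w [0])

/-- Strong Turing reducibility `A ≼ B`: some machine in `M_add^1(B)` decides `A`. -/
def Reducible (A B : Set (List ℝ)) : Prop :=
  ∃ P : Program, P.Decides B A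

/-- The single symbols in which programs are written. -/
inductive Symbol where
  | regZ | regI | zero | one | plus | minus | assign | equal | geq | branch | thenGoto | elseGoto
  | query | colon | semicolon

/-- Binary notation of a positive number. -/
def Symbol.binary (n : ℕ) : List Symbol :=
  (Nat.digits 2 n).reverse.map fun d => if d = 0 then .zero else .one

/-- `then goto l₁ else goto l₂`; labels are written starting from `1`. -/
def Symbol.jump (l₁ l₂ : ℕ) : List Symbol :=
  .thenGoto :: binary (l₁ + 1) ++ .elseGoto :: binary (l₂ + 1)

open AddBSS.Symbol in
/-- The text of an instruction. -/
def Instr.text : Instr → List Symbol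
  | .add i j k => regZ :: binary i ++ assign :: regZ :: binary j ++ plus :: regZ :: binary k
  | .sub i j k => regZ :: binary i ++ assign :: regZ :: binary j ++ minus :: regZ :: binary k
  | .setZero j => regZ :: binary j ++ [assign, zero]
  | .setOne j => regZ :: binary j ++ [assign, one]
  | .ifNonneg j l₁ l₂ => branch :: regZ :: binary j ++ geq :: zero :: jump l₁ l₂
  | .copy j k => regZ :: regI :: binary j ++ assign :: regZ :: regI :: binary k
  | .idxOne j => regI :: binary j ++ [assign, one]
  | .idxSucc j => regI :: binary j ++ assign :: regI :: binary j ++ [plus, one]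
  | .ifIdxEq j k l₁ l₂ =>
      branch :: regI :: binary j ++ equal :: regI :: binary k ++ jump l₁ l₂
  | .ifOracle l₁ l₂ => branch :: query :: jump l₁ l₂

/-- The text of a program: its labeled instructions in order. -/
def Program.text (P : Program) : List Symbol :=
  (P.mapIdx fun l ins =>
    Symbol.binary (l + 1) ++ Symbol.colon :: ins.text ++ [Symbol.semicolon]).flatten

/-- The code of a program, a tuple over `{0, 1}`: each symbol `s` of the text is replaced by the
block `enc s` of `k` zeros and ones. -/
noncomputable def Program.code {k : ℕ} (enc : Symbol → Fin k → Bool) (P : Program) : List ℝ :=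
  P.text.flatMap fun s => List.ofFn fun t => if enc s t then (1 : ℝ) else 0

/-- `√p_i`, where `p_1 = 2, p_2 = 3, …` are the primes in increasing order (used for `i ≥ 1`). -/
noncomputable def sqrtPrime (i : ℕ) : ℝ := Real.sqrt (Nat.nth Nat.Prime (i - 1) : ℝ)

/-- `ℙ_i = {(2, i, x, code(K)) | x ∈ ℝ, x ≠ √p_i}`. -/
def primeProblem {k : ℕ} (enc : Symbol → Fin k → Bool) (K : Program) (i : ℕ) : Set (List ℝ) :=
  {w | ∃ x : ℝ, x ≠ sqrtPrime i ∧ w = [2, (i : ℝ), x] ++ K.code enc}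

end AddBSS

namespace AddBSS

open Filter Topology

/-! Let α = √p_{i+1}, and run an additive machine on one-element inputs `x` near α. As only sums,
differences and the constants 0 and 1 are available, each register holds `a + b * x` with integers
`a`, `b`. A sign test gives the same answer for all `x` near α: if a + bα ≠ 0 this is continuity,
and if a + bα = 0, irrationality forces a = b = 0, so the register is zero for every `x`. Oracle
queries are stable for the same reason, since √p_j with j ≤ i is never of the form a + bα
(`affine_sqrt_prime_ne_sqrt_prime`). An accepting run on α therefore also accepts some x ≠ α, which
is absurd. `not_reducible_singleton` carries this out for any oracle satisfying `LocallyConstantAt`.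
-/

/-- The configurations `C x` agree, for `x` near `α`, up to register contents that are
integral affine functions of `x`. -/
def LocallyAffine (α : ℝ) (C : ℝ → Config) : Prop :=
  ∃ (l : ℕ) (a b : ℕ+ → ℤ) (idx : ℕ+ → ℕ+),
    ∀ᶠ x in 𝓝 α, C x = ⟨l, fun j => a j + b j * x, idx⟩

/-- Membership in `O` of a tuple of integral affine functions is constant near `α`. -/
def LocallyConstantAt (α : ℝ) (O : Set (List ℝ)) : Prop :=
  ∀ (n : ℕ) (a b : ℕ → ℤ), ∀ᶠ x in 𝓝 α,
    (((List.range n).map fun m => (a m + b m * x : ℝ)) ∈ O ↔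
      ((List.range n).map fun m => (a m + b m * α : ℝ)) ∈ O)

/-! ### Integral affine functions near an irrational point -/

theorem tendsto_affine (α : ℝ) (a b : ℤ) :
    Tendsto (fun x : ℝ => (a + b * x : ℝ)) (𝓝 α) (𝓝 (a + b * α)) :=
  (by fun_prop : Continuous fun x : ℝ => (a + b * x : ℝ)).tendsto α

theorem affine_eq_int_iff {α : ℝ} (hα : Irrational α) (a b q : ℤ) :
    (a + b * α : ℝ) = q ↔ a = q ∧ b = 0 := by
  constructor
  · intro h
    have hb : b = 0 := by
      by_contra hb
      refine (hα.intCast_mul hb).ne_int (q - a) ?_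
      push_cast
      linarith
    subst hb
    exact ⟨by simpa using h, rfl⟩
  · rintro ⟨rfl, rfl⟩
    simp

theorem eventually_affine_eq_int_iff {α : ℝ} (hα : Irrational α) (a b q : ℤ) :
    ∀ᶠ x in 𝓝 α, ((a + b * x : ℝ) = q ↔ (a + b * α : ℝ) = q) := by
  by_cases h : (a + b * α : ℝ) = q
  · obtain ⟨rfl, rfl⟩ := (affine_eq_int_iff hα a b q).1 h
    simp
  · filter_upwards [(tendsto_affine α a b).eventually_ne h] with x hx
    simp [hx, h]

theorem eventually_affine_nonneg_iff {α : ℝ} (hα : Irrational α) (a b : ℤ) :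
    ∀ᶠ x in 𝓝 α, (0 ≤ (a + b * x : ℝ) ↔ 0 ≤ (a + b * α : ℝ)) := by
  rcases lt_trichotomy (a + b * α : ℝ) 0 with h | h | h
  · filter_upwards [(tendsto_affine α a b).eventually_lt_const h] with x hx
    exact iff_of_false hx.not_ge h.not_ge
  · obtain ⟨rfl, rfl⟩ := (affine_eq_int_iff hα a b 0).1 (by simpa using h)
    simp
  · filter_upwards [(tendsto_affine α a b).eventually_const_lt h] with x hx
    simp [hx.le, h.le]

/-! ### Stability of computations near an irrational input -/

open Classical in
theorem LocallyAffine.exec {α : ℝ} {O : Set (List ℝ)} (hα : Irrational α)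
    (hO : LocallyConstantAt α O) {C : ℝ → Config} (hC : LocallyAffine α C) (ins : Instr) :
    LocallyAffine α fun x => ins.exec O (C x) := by
  obtain ⟨l, a, b, idx, h⟩ := hC
  have upd : ∀ (i : ℕ+) (u v : ℤ),
      (fun x : ℝ => Function.update (fun j => (a j + b j * x : ℝ)) i (u + v * x)) =
      fun (x : ℝ) j => ((Function.update a i u j : ℤ) + (Function.update b i v j : ℤ) * x : ℝ) := by
    intro i u v
    ext x j
    rcases eq_or_ne j i with rfl | hj <;> simp [*]
  have assign : ∀ (i : ℕ+) (u v : ℤ) (r : ℝ → ℝ), (∀ x, r x = u + v * x) →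
      (∀ᶠ x in 𝓝 α, ins.exec O (C x) =
        ⟨l + 1, Function.update (fun j => (a j + b j * x : ℝ)) i (r x), idx⟩) →
      LocallyAffine α fun x => ins.exec O (C x) := by
    intro i u v r hr he
    refine ⟨l + 1, Function.update a i u, Function.update b i v, idx, ?_⟩
    filter_upwards [he] with x hx
    rw [hx, hr, congrFun (upd i u v) x]
  cases ins with
  | add i j k =>
    refine assign i (a j + a k) (b j + b k) _ (fun x => ?_) (h.mono fun x hx => by
      rw [hx, Instr.exec])
    push_cast; ring
  | sub i j k =>
    refine assign i (a j - a k) (b j - b k) _ (fun x => ?_) (h.mono fun x hx => by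
      rw [hx, Instr.exec])
    push_cast; ring
  | setZero j =>
    exact assign j 0 0 (fun _ => 0) (fun x => by simp) (h.mono fun x hx => by
      rw [hx, Instr.exec])
  | setOne j =>
    exact assign j 1 0 (fun _ => 1) (fun x => by simp) (h.mono fun x hx => by
      rw [hx, Instr.exec])
  | copy j k =>
    exact assign (idx j) (a (idx k)) (b (idx k)) _ (fun x => rfl) (h.mono fun x hx => by
      rw [hx, Instr.exec])
  | idxOne j =>
    exact ⟨l + 1, a, b, Function.update idx j 1, h.mono fun x hx => by simp only [hx, Instr.exec]⟩
  | idxSucc j =>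
    exact ⟨l + 1, a, b, Function.update idx j (idx j + 1),
      h.mono fun x hx => by simp only [hx, Instr.exec]⟩
  | ifIdxEq j k l₁ l₂ =>
    exact ⟨if idx j = idx k then l₁ else l₂, a, b, idx, h.mono fun x hx => by
      simp only [hx, Instr.exec]⟩
  | ifNonneg j l₁ l₂ =>
    refine ⟨if 0 ≤ (a j + b j * α : ℝ) then l₁ else l₂, a, b, idx, ?_⟩
    filter_upwards [h, eventually_affine_nonneg_iff hα (a j) (b j)] with x hx hs
    simp only [hx, Instr.exec, hs]
  | ifOracle l₁ l₂ =>
    refine ⟨if ((List.range (idx 1)).map fun m => (a m.succPNat + b m.succPNat * α : ℝ)) ∈ O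
      then l₁ else l₂, a, b, idx, ?_⟩
    filter_upwards [h, hO (idx 1) (fun m => a m.succPNat) fun m => b m.succPNat] with x hx hs
    simp only [hx, Instr.exec, Config.tuple, hs]

theorem LocallyAffine.step {α : ℝ} {O : Set (List ℝ)} (hα : Irrational α)
    (hO : LocallyConstantAt α O) (P : Program) {C : ℝ → Config} (hC : LocallyAffine α C) :
    LocallyAffine α fun x => P.step O (C x) := by
  obtain ⟨l, a, b, idx, h⟩ := id hC
  cases hl : P[l]? with
  | none =>
    refine ⟨l, a, b, idx, h.mono fun x hx => ?_⟩
    simp only [Program.step, hx, hl]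
  | some ins =>
    obtain ⟨l', a', b', idx', h'⟩ := hC.exec hα hO ins
    refine ⟨l', a', b', idx', ?_⟩
    filter_upwards [h, h'] with x hx hx'
    rw [← hx']
    simp only [Program.step, hx, hl]

theorem locallyAffine_init (α : ℝ) : LocallyAffine α fun x => Config.init [x] := by
  -- The input has length one: `Z₁` holds `0 + 1 * x`, the other registers hold 0, and every index
  -- register holds 1.
  refine ⟨0, 0, fun j => if j.natPred = 0 then 1 else 0, fun _ => 1, .of_forall fun x => ?_⟩
  simp only [Config.init, Config.mk.injEq, true_and]
  refine ⟨?_, rfl⟩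
  funext j
  rcases hj : j.natPred with _ | n <;> simp

/-- The neighbourhood may shrink as `t` grows; this is harmless, because only the halting time of a
single run is used. -/
theorem locallyAffine_iterate {α : ℝ} {O : Set (List ℝ)} (hα : Irrational α)
    (hO : LocallyConstantAt α O) (P : Program) (t : ℕ) :
    LocallyAffine α fun x => (P.step O)^[t] (Config.init [x]) := by
  induction t with
  | zero => exact locallyAffine_init α
  | succ t ih =>
    simp only [Function.iterate_succ_apply']
    exact ih.step hα hO P

theorem Program.iterate_step_of_halted {P : Program} {O : Set (List ℝ)} {c : Config}
    (hc : P.length ≤ c.label) (s : ℕ) : (P.step O)^[s] c = c := by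
  refine Function.iterate_fixed ?_ s
  simp [Program.step, List.getElem?_eq_none hc]

theorem Program.HaltsWith.unique {P : Program} {O : Set (List ℝ)} {w u v : List ℝ}
    (hu : P.HaltsWith O w u) (hv : P.HaltsWith O w v) : u = v := by
  obtain ⟨s, hs, rfl⟩ := hu
  obtain ⟨t, ht, rfl⟩ := hv
  rcases le_total s t with h | h <;> obtain ⟨d, rfl⟩ := Nat.exists_eq_add_of_le' h
  · rw [Function.iterate_add_apply, iterate_step_of_halted hs]
  · rw [Function.iterate_add_apply, iterate_step_of_halted ht]

/-- A computation on an irrational input with an integer as output has the same output on all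
nearby inputs. -/
theorem Program.HaltsWith.eventually {α : ℝ} {O : Set (List ℝ)} (hα : Irrational α)
    (hO : LocallyConstantAt α O) {P : Program} {q : ℤ} (h : P.HaltsWith O [α] [(q : ℝ)]) :
    ∀ᶠ x in 𝓝 α, P.HaltsWith O [x] [(q : ℝ)] := by
  obtain ⟨t, hl, ht⟩ := h
  obtain ⟨l, a, b, idx, hC⟩ := locallyAffine_iterate hα hO P t
  have hCα := hC.self_of_nhds
  simp only at hCα
  rw [hCα] at hl ht
  -- The output is a single number, so `I₁` contains 1 and only `Z₁` has to be controlled.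
  have hn : (idx 1 : ℕ) = 1 := by simpa [Config.tuple] using congrArg List.length ht
  simp only [Config.tuple, hn, List.range_one, List.map_cons, List.map_nil, List.cons.injEq,
    and_true] at ht
  filter_upwards [hC, eventually_affine_eq_int_iff hα (a (Nat.succPNat 0)) (b (Nat.succPNat 0)) q]
    with x hx hq
  refine ⟨t, ?_, ?_⟩
  · rw [hx]; exact hl
  · simp [hx, Config.tuple, hn, hq.2 ht]

theorem not_reducible_singleton {α : ℝ} {O : Set (List ℝ)} (hα : Irrational α)
    (hO : LocallyConstantAt α O) : ¬ Reducible {[α]} O := by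
  rintro ⟨P, hP⟩
  have h₁ : P.HaltsWith O [α] [((1 : ℤ) : ℝ)] := by
    simpa using (hP [α] (by simp)).1 rfl
  -- α is not isolated in ℝ, so some x ≠ α is accepted too.
  obtain ⟨x, hx, hne⟩ := (((h₁.eventually hα hO).filter_mono nhdsWithin_le_nhds).and
    (self_mem_nhdsWithin : {α}ᶜ ∈ 𝓝[≠] α)).exists
  have h₀ := (hP [x] (by simp)).2 (by simpa using hne)
  simpa using hx.unique h₀

/-! ### Stability of the two oracles at √p_{i+1} -/

theorem irrational_sqrtPrime (i : ℕ) : Irrational (sqrtPrime i) :=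
  (Nat.prime_nth_prime _).irrational_sqrt

/-- Squaring makes 2ab√p an integer, hence ab = 0. If a = 0, then p divides q; if b = 0, then √q is
an integer. -/
theorem affine_sqrt_prime_ne_sqrt_prime {p q : ℕ} (hp : p.Prime) (hq : q.Prime) (hpq : p ≠ q)
    (a b : ℤ) : (a + b * √p : ℝ) ≠ √q := by
  intro h
  have hsq : (2 * a * b : ℤ) * √(p : ℝ) = ((q - a ^ 2 - b ^ 2 * p : ℤ) : ℝ) := by
    have h2 := congrArg (· ^ 2) h
    simp only [Real.sq_sqrt (Nat.cast_nonneg q)] at h2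
    have hp2 : √(p : ℝ) ^ 2 = p := Real.sq_sqrt (Nat.cast_nonneg p)
    push_cast
    linear_combination h2 - b ^ 2 * hp2
  have hab : 2 * a * b = 0 := by
    by_contra hab
    exact (hp.irrational_sqrt.intCast_mul hab).ne_int _ hsq
  have hq0 : (q - a ^ 2 - b ^ 2 * p : ℤ) = 0 := by
    rw [hab] at hsq
    exact_mod_cast (by simpa using hsq.symm : ((q - a ^ 2 - b ^ 2 * p : ℤ) : ℝ) = 0)
  rcases mul_eq_zero.1 hab with ha | rfl
  · obtain rfl : a = 0 := by simpa using ha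
    have : (p : ℤ) ∣ q := ⟨b ^ 2, by linarith⟩
    exact hpq ((Nat.prime_dvd_prime_iff_eq hp hq).1 (by exact_mod_cast this))
  · exact hq.irrational_sqrt.ne_int a (by simpa using h.symm)

theorem affine_sqrtPrime_ne {i j : ℕ} (hj : j ∈ Set.Icc 1 i) (a b : ℤ) :
    (a + b * sqrtPrime (i + 1) : ℝ) ≠ sqrtPrime j := by
  refine affine_sqrt_prime_ne_sqrt_prime (Nat.prime_nth_prime _) (Nat.prime_nth_prime _) ?_ a b
  intro h
  have := Nat.nth_injective Nat.infinite_setOfPred_prime h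
  have := hj.1
  have := hj.2
  omega

theorem eventually_affine_ne_sqrtPrime {i j : ℕ} (hj : j ∈ Set.Icc 1 i) (a b : ℤ) :
    ∀ᶠ x in 𝓝 (sqrtPrime (i + 1)), (a + b * x : ℝ) ≠ sqrtPrime j :=
  (tendsto_affine _ a b).eventually_ne (affine_sqrtPrime_ne hj a b)

theorem locallyConstantAt_sqrtPrimes (i : ℕ) :
    LocallyConstantAt (sqrtPrime (i + 1)) {w | ∃ j ∈ Set.Icc 1 i, w = [sqrtPrime j]} := by
  intro n a b
  have h : ∀ᶠ x in 𝓝 (sqrtPrime (i + 1)), ∀ j ∈ Set.Icc 1 i,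
      (a 0 + b 0 * x : ℝ) ≠ sqrtPrime j :=
    (eventually_all_finite (Set.finite_Icc 1 i)).2 fun j hj =>
      eventually_affine_ne_sqrtPrime hj _ _
  have key : ∀ x : ℝ, (∀ j ∈ Set.Icc 1 i, (a 0 + b 0 * x : ℝ) ≠ sqrtPrime j) →
      ((List.range n).map fun m => (a m + b m * x : ℝ)) ∉
        {w | ∃ j ∈ Set.Icc 1 i, w = [sqrtPrime j]} := by
    rintro x hx ⟨j, hj, hw⟩
    obtain rfl : n = 1 := by simpa using congrArg List.length hw
    exact hx j hj (by simpa using hw)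
  filter_upwards [h] with x hx
  exact iff_of_false (key x hx) (key _ h.self_of_nhds)

theorem Program.exists_int_code {k : ℕ} (enc : Symbol → Fin k → Bool) (K : Program) :
    ∃ c : List ℤ, K.code enc = c.map (↑) := by
  refine ⟨K.text.flatMap fun s => List.ofFn fun t => if enc s t then (1 : ℤ) else 0, ?_⟩
  simp [Program.code, List.map_flatMap, List.map_ofFn, Function.comp_def]

/-- Splits membership into finitely many equations with integer right-hand sides and one inequality
with √p_j, each of which is stable near α when `f` is affine. -/
theorem affine_mem_primeProblem_iff {k : ℕ} (enc : Symbol → Fin k → Bool) (K : Program)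
    {c : List ℤ} (hc : K.code enc = c.map (↑)) (j n : ℕ) (f : ℕ → ℝ) :
    (List.range n).map f ∈ primeProblem enc K j ↔
      n = c.length + 3 ∧ f 0 = (2 : ℤ) ∧ f 1 = (j : ℤ) ∧ f 2 ≠ sqrtPrime j ∧
        ∀ m ∈ Finset.range c.length, f (m + 3) = (c.getD m 0 : ℤ) := by
  have hr : ∀ l, (List.range (l + 3)).map f =
      f 0 :: f 1 :: f 2 :: (List.range l).map fun m => f (m + 3) := by
    intro l
    simp [List.range_succ_eq_map, Function.comp_def]
  have ht : ((List.range c.length).map fun m => f (m + 3)) = c.map (↑) ↔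
      ∀ m ∈ Finset.range c.length, f (m + 3) = (c.getD m 0 : ℤ) := by
    rw [List.ext_getElem_iff]
    simp only [List.length_map, List.length_range, true_and, List.getElem_map,
      List.getElem_range, Finset.mem_range]
    exact forall_congr' fun m =>
      ⟨fun h hm => by simpa [hm] using h hm hm, fun h hm _ => by simpa [hm] using h hm⟩
  rw [← ht]
  constructor
  · rintro ⟨y, hy, hw⟩
    obtain rfl : n = c.length + 3 := by simpa [hc] using congrArg List.length hw
    rw [hr, hc] at hw
    simp only [List.cons_append, List.nil_append, List.cons.injEq] at hw
    obtain ⟨h0, h1, rfl, h3⟩ := hw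
    exact ⟨rfl, by simpa using h0, by simpa using h1, hy, h3⟩
  · rintro ⟨rfl, h0, h1, h2, h3⟩
    refine ⟨f 2, h2, ?_⟩
    rw [hr, h3, hc, h0, h1]
    simp

theorem locallyConstantAt_primeProblems {k : ℕ} (enc : Symbol → Fin k → Bool) (K : Program)
    (i : ℕ) :
    LocallyConstantAt (sqrtPrime (i + 1)) (⋃ j ∈ Set.Icc 1 i, primeProblem enc K j) := by
  intro n a b
  obtain ⟨c, hc⟩ := K.exists_int_code enc
  have hα := irrational_sqrtPrime (i + 1)
  have h : ∀ᶠ x in 𝓝 (sqrtPrime (i + 1)), ∀ j ∈ Set.Icc 1 i,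
      (((List.range n).map fun m => (a m + b m * x : ℝ)) ∈ primeProblem enc K j ↔
      ((List.range n).map fun m => (a m + b m * sqrtPrime (i + 1) : ℝ)) ∈
        primeProblem enc K j) := by
    refine (eventually_all_finite (Set.finite_Icc 1 i)).2 fun j hj => ?_
    have hcode := (Filter.eventually_all_finset (Finset.range c.length)).2 fun m _ =>
      eventually_affine_eq_int_iff hα (a (m + 3)) (b (m + 3)) (c.getD m 0)
    filter_upwards [eventually_affine_eq_int_iff hα (a 0) (b 0) 2,
      eventually_affine_eq_int_iff hα (a 1) (b 1) j,
      eventually_affine_ne_sqrtPrime hj (a 2) (b 2), hcode] with x h0 h1 h2 h3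
    -- The inequality with √p_j is true both at `x` and at α, so it drops out; the integer equations
    -- match one by one.
    rw [affine_mem_primeProblem_iff enc K hc, affine_mem_primeProblem_iff enc K hc, h0, h1,
      iff_true_intro h2, iff_true_intro (affine_sqrtPrime_ne hj (a 2) (b 2)),
      forall₂_congr h3]
  filter_upwards [h] with x hx
  simp only [Set.mem_iUnion, exists_prop]
  exact exists_congr fun j => and_congr_right (hx j)

end AddBSS

/-- The statement holds for every machine `K` of `M_add^1`, in particular for each one that
semi-decides the set of all `(i, x)` with `i ≥ 1` and `x ≠ √p_i`. -/
theorem mainTheorem8 (i : ℕ) (hi : 1 ≤ i) :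
    (∀ (k : ℕ) (enc : AddBSS.Symbol → Fin k → Bool), Function.Injective enc →
      ∀ K : AddBSS.Program, K.OracleFree →
        ¬ AddBSS.Reducible {[AddBSS.sqrtPrime (i + 1)]}
          (⋃ j ∈ Set.Icc 1 i, AddBSS.primeProblem enc K j)) ∧
    ¬ AddBSS.Reducible {[AddBSS.sqrtPrime (i + 1)]}
      {w | ∃ j ∈ Set.Icc 1 i, w = [AddBSS.sqrtPrime j]} := by
  exact ⟨fun _ enc _ K _ => AddBSS.not_reducible_singleton (AddBSS.irrational_sqrtPrime _)
      (AddBSS.locallyConstantAt_primeProblems enc K i),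
    AddBSS.not_reducible_singleton (AddBSS.irrational_sqrtPrime _)
      (AddBSS.locallyConstantAt_sqrtPrimes i)⟩
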